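/- Let $(X,\mathcal M,\mu)$ be a $\sigma$-finite, complete measure space with $L^2(X)$ separable, let $\mathcal H$ be a separable complex Hilbert space, let $I$ be a countable index set, and let $(Y,\nu)$ be a $\sigma$-finite measure space. Let $\{g_t\}_{t\in Y}\subset L^\infty(X)$ be a Parseval determining set for $L^1(X)$: for every $f\in L^1(X)$ the function $t\mapsto\int_X f\,\overline{g_t}\,d\mu$ is measurable on $Y$ and \[ \int_Y\Bigl|\int_X f\,\overline{g_t}\,d\mu\Bigr|^2d\nu(t)=\int_X|f|^2\,d\mu \] (possibly both sides are infinite). For $\phi\in L^\infty(X)$ let $M_\phi$ denote pointwise multiplication by $\phi$ on vector-valued $L^2$-spaces over $X$. For a family $\{\varphi_i\}_{i\in I}$ in $L^2(X;\mathcal H)$ put $E(\{\varphi_i\}_{i\in I})=\{M_{g_t}\varphi_i\}_{(t,i)\in Y\times I}$, where $Y\times I$ carries the product of $\nu$ and counting measure. A system $\{u_s\}_{s\in S}$ in a Hilbert space $\mathcal K$, indexed by a measure space $(S,m)$, is Bessel if $s\mapsto\langle v,u_s\rangle$ is measurable for every $v\in\mathcal K$ and there is $B>0$ with $\int_S|\langle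 v,u_s\rangle|^2\,dm(s)\le B\|v\|^2$ for every $v\in\mathcal K$. Two Bessel systems $\{u_s\}_{s\in S}$, $\{u'_s\}_{s\in S}$ are unitarily equivalent if there is a unitary $U\colon\overline{\operatorname{span}}\{u_s\}\to\overline{\operatorname{span}}\{u'_s\}$ with $Uu_s=u'_s$ for every $s\in S$. The Gramian of a Bessel family $\{u_i\}_{i\in I}$ in $\mathcal H$ (counting measure on $I$) is $TT^*\colon\ell^2(I)\to\ell^2(I)$, where $T\colon\mathcal H\to\ell^2(I)$, $Tv=\{\langle v,u_i\rangle\}_{i\in I}$. A bounded operator on $L^2(X;\ell^2(I))$ is multiplication-invariant (MI) if it commutes with $M_\phi$ for every $\phi\in L^\infty(X)$. For an essentially bounded, weakly measurable field $\{R(x)\}_{x\in X}$ of operators on $\ell^2(I)$, $\int_X^\oplus R(x)\,d\mu(x)$ denotes the operator $\psi\mapsto R(\cdot)\psi(\cdot)$. A positive MI operator $\int_X^\oplus\mathrm{Gr}(x)\,d\mu(x)$ on $L^2(X;\ell^2(I))$ is integrable if $\int_X\langle\mathrm{Gr}(x)\delta_i,\delta_i\rangle\,d\mu(x)<\infty$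 for every $i\in I$, where $\delta_i$ is the canonical basis element. Dimensions and ranks are Hilbert space dimensions in $\{0,1,2,\dots,\infty\}$, the rank of an operator being the dimension of the closure of its range. Then there is a bijection from the set of unitary equivalence classes of Bessel systems of the form $E(\{\varphi_i\}_{i\in I})$ in $L^2(X;\mathcal H)$ onto the set of positive, integrable MI operators $\int_X^\oplus\mathrm{Gr}(x)\,d\mu(x)$ on $L^2(X;\ell^2(I))$ with $\operatorname{rank}\mathrm{Gr}(x)\le\dim\mathcal H$ for a.e. $x\in X$, under which the class of $E(\{\varphi_i\}_{i\in I})$ corresponds to the operator $\int_X^\oplus\mathrm{Gr}(x)\,d\mu(x)$ for which $\mathrm{Gr}(x)$ is the Gramian of $\{\varphi_i(x)\}_{i\in I}$ for a.e. $x\in X$. -/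

import Mathlib

open MeasureTheory
open scoped ENNReal InnerProductSpace InnerProduct

noncomputable section

/-- The space `ℓ²(I)` of square-summable complex families indexed by `I`. -/
abbrev EllTwo (I : Type*) : Type _ := lp (fun _ : I => ℂ) 2

/-- The canonical basis element `δᵢ` of `ℓ²(I)`. -/
def ellTwoDelta {I : Type*} (i : I) : EllTwo I :=
  letI : DecidableEq I := Classical.decEq I
  lp.single 2 i (1 : ℂ)

/-- The Hilbert space dimension, in `{0, 1, 2, …, ∞}`, of a complex inner product space: the
number of elements of a basis if this is finite, and `∞` otherwise. On separable Hilbert spaces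
this is the cardinality of an orthonormal basis. -/
def hilbertDim (K : Type*) [NormedAddCommGroup K] [InnerProductSpace ℂ K] : ℕ∞ :=
  Cardinal.toENat (Module.rank ℂ K)

/-- The rank of a bounded operator, in `{0, 1, 2, …, ∞}`: the dimension of the closure of its
range. -/
def operatorRank {K K' : Type*} [NormedAddCommGroup K] [InnerProductSpace ℂ K]
    [NormedAddCommGroup K'] [InnerProductSpace ℂ K'] (A : K →L[ℂ] K') : ℕ∞ :=
  hilbertDim (LinearMap.range (A : K →ₗ[ℂ] K')).topologicalClosure

section BesselSystems

variable {S : Type*} {K K' : Type*}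
  [NormedAddCommGroup K] [InnerProductSpace ℂ K]
  [NormedAddCommGroup K'] [InnerProductSpace ℂ K']

/-- A system `{u_s}`, indexed by a measure space `(S, m)`, is Bessel in the Hilbert space `K` if
for every `v` the function `s ↦ ⟨v, u_s⟩` is measurable and, for some `B > 0` independent of `v`,
`∫ |⟨v, u_s⟩|² dm(s) ≤ B ‖v‖²`. Mathlib's inner product is linear in its second argument, so
`⟨v, u_s⟩` reads `⟪u s, v⟫_ℂ`. -/
structure IsBesselSystem [MeasurableSpace S] (m : Measure S) (u : S → K) : Prop where
  measurable_inner : ∀ v : K, Measurable fun s => ⟪u s, v⟫_ℂ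
  exists_bound : ∃ B : ℝ, 0 < B ∧
    ∀ v : K, ∫⁻ s, ‖⟪u s, v⟫_ℂ‖ₑ ^ 2 ∂m ≤ ENNReal.ofReal (B * ‖v‖ ^ 2)

/-- The closed linear span of a system. -/
def closedSpan (u : S → K) : Submodule ℂ K :=
  (Submodule.span ℂ (Set.range u)).topologicalClosure

theorem mem_closedSpan (u : S → K) (s : S) : u s ∈ closedSpan u :=
  Submodule.le_topologicalClosure _ (Submodule.subset_span (Set.mem_range_self s))

/-- Two systems `{u_s}` and `{u'_s}` with the same index set are unitarily equivalent if there is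
a unitary between their closed linear spans that maps `u_s` to `u'_s` for every `s`. -/
def UnitarilyEquivalent (u : S → K) (u' : S → K') : Prop :=
  ∃ U : closedSpan u ≃ₗᵢ[ℂ] closedSpan u',
    ∀ s, U ⟨u s, mem_closedSpan u s⟩ = ⟨u' s, mem_closedSpan u' s⟩

theorem unitarilyEquivalent_equivalence :
    Equivalence (fun u u' : S → K => UnitarilyEquivalent u u') where
  refl u := ⟨LinearIsometryEquiv.refl ℂ _, fun _ => rfl⟩
  symm := by
    rintro u u' ⟨U, hU⟩
    exact ⟨U.symm, fun s => by rw [← hU s, LinearIsometryEquiv.symm_apply_apply]⟩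
  trans := by
    rintro u u' u'' ⟨U, hU⟩ ⟨V, hV⟩
    exact ⟨U.trans V, fun s => by rw [LinearIsometryEquiv.trans_apply, hU s, hV s]⟩

/-- `G` is the Gramian `T T*` of the family `{u_i}`, where `T : K → ℓ²(I)`,
`T v = {⟨v, u_i⟩}_i`, is its analysis operator (the existence of a bounded such `T` says that the
family is Bessel). -/
def IsGramian [CompleteSpace K] {I : Type*} (u : I → K)
    (G : EllTwo I →L[ℂ] EllTwo I) : Prop :=
  ∃ T : K →L[ℂ] EllTwo I, (∀ (v : K) (i : I), T v i = ⟪u i, v⟫_ℂ) ∧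
    G = T ∘L ContinuousLinearMap.adjoint T

end BesselSystems

section Multiplications

variable {X : Type*} [MeasurableSpace X] {μ : Measure X}
  {Y : Type*} [MeasurableSpace Y]
  {K K' : Type*} [NormedAddCommGroup K] [InnerProductSpace ℂ K]
  [NormedAddCommGroup K'] [InnerProductSpace ℂ K']

/-- The multiplication operator `M_φ` on `L²(X; K)`, for `φ ∈ L^∞(X)`:
`(M_φ ψ)(x) = φ(x) ψ(x)` for almost every `x`. -/
def mulOp (φ : Lp ℂ ∞ μ) (ψ : Lp K 2 μ) : Lp K 2 μ := φ • ψ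

theorem mulOp_coeFn (φ : Lp ℂ ∞ μ) (ψ : Lp K 2 μ) :
    mulOp φ ψ =ᵐ[μ] fun x => φ x • ψ x :=
  Lp.coeFn_lpSMul φ ψ

/-- A family `{g_t}`, `t ∈ Y`, in `L^∞(X)` is a Parseval determining set for `L¹(X)`. -/
structure IsParsevalDeterminingSet (ν : Measure Y) (g : Y → Lp ℂ ∞ μ) : Prop where
  measurable_integral : ∀ f : Lp ℂ 1 μ,
    Measurable fun t => ∫ x, f x * (starRingEnd ℂ) (g t x) ∂μ
  parseval : ∀ f : Lp ℂ 1 μ,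
    ∫⁻ t, ‖∫ x, f x * (starRingEnd ℂ) (g t x) ∂μ‖ₑ ^ 2 ∂ν = ∫⁻ x, ‖f x‖ₑ ^ 2 ∂μ

/-- The system of multiplications `E({φ_i}) = {M_{g_t} φ_i}`, indexed by `(t, i) ∈ Y × I`. -/
def mulSystem {I : Type*} (g : Y → Lp ℂ ∞ μ) (φ : I → Lp K 2 μ) : Y × I → Lp K 2 μ :=
  fun p => mulOp (g p.1) (φ p.2)

/-- The Bessel systems of multiplications `E({φ_i})` in `L²(X; K)`. The index set `Y × I` carries
the product of `ν` with counting measure on `I`. -/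
def BesselMulSystem (ν : Measure Y) (g : Y → Lp ℂ ∞ μ) (I : Type*) [MeasurableSpace I]
    (K : Type*) [NormedAddCommGroup K] [InnerProductSpace ℂ K] :=
  { u : Y × I → Lp K 2 μ //
    (∃ φ : I → Lp K 2 μ, u = mulSystem g φ) ∧ IsBesselSystem (ν.prod Measure.count) u }

/-- The Bessel system of multiplications generated by `{φ_i}`. -/
def BesselMulSystem.of {ν : Measure Y} {g : Y → Lp ℂ ∞ μ} {I : Type*} [MeasurableSpace I]
    (φ : I → Lp K 2 μ) (h : IsBesselSystem (ν.prod Measure.count) (mulSystem g φ)) :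
    BesselMulSystem ν g I K :=
  ⟨mulSystem g φ, ⟨φ, rfl⟩, h⟩

/-- Unitary equivalence of Bessel systems of multiplications. -/
def besselMulSetoid (ν : Measure Y) (g : Y → Lp ℂ ∞ μ) (I : Type*) [MeasurableSpace I]
    (K : Type*) [NormedAddCommGroup K] [InnerProductSpace ℂ K] :
    Setoid (BesselMulSystem ν g I K) where
  r E E' := UnitarilyEquivalent E.1 E'.1
  iseqv := unitarilyEquivalent_equivalence.comap Subtype.val

/-- A bounded operator between `L²(X; K)` and `L²(X; K')` is multiplication-invariant (MI) if it
commutes with multiplication by every element of `L^∞(X)`. -/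
def IsMIOperator (T : Lp K 2 μ →L[ℂ] Lp K' 2 μ) : Prop :=
  ∀ (φ : Lp ℂ ∞ μ) (ψ : Lp K 2 μ), T (mulOp φ ψ) = mulOp φ (T ψ)

/-- `R` is a bounded measurable range operator (a field of operators `R x : K → K'`, `x ∈ X`,
essentially bounded and weakly measurable) and `T = ∫^⊕ R(x) dμ(x)`, that is,
`(T ψ)(x) = R(x) (ψ(x))` for almost every `x`, for all `ψ ∈ L²(X; K)`. -/
structure IsDirectIntegral (T : Lp K 2 μ →L[ℂ] Lp K' 2 μ) (R : X → K →L[ℂ] K') : Prop where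
  bounded : ∃ C : ℝ, ∀ᵐ x ∂μ, ‖R x‖ ≤ C
  measurable : ∀ (u : K) (v : K'), Measurable fun x => ⟪v, R x u⟫_ℂ
  apply_ae : ∀ ψ : Lp K 2 μ, T ψ =ᵐ[μ] fun x => R x (ψ x)

/-- The positive, integrable MI operators `∫^⊕ Gr(x) dμ(x)` on `L²(X; ℓ²(I))` whose fibers satisfy
`rank Gr(x) ≤ d` for almost every `x`. -/
def PosIntegrableMIOperator (μ : Measure X) (I : Type*) (d : ℕ∞) :=
  { T : Lp (EllTwo I) 2 μ →L[ℂ] Lp (EllTwo I) 2 μ //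
    IsMIOperator T ∧ T.IsPositive ∧
      ∃ Gr : X → EllTwo I →L[ℂ] EllTwo I, IsDirectIntegral T Gr ∧
        (∀ i : I, Integrable (fun x => ⟪ellTwoDelta i, Gr x (ellTwoDelta i)⟫_ℂ) μ) ∧
        ∀ᵐ x ∂μ, operatorRank (Gr x) ≤ d }

end Multiplications

end

/-! Two systems in Hilbert spaces are unitarily equivalent exactly when their Gram kernels agree.
The kernel of $E(\{\varphi_i\})$ consists of the integrals of the functions
$\langle\varphi_i(x),\varphi_j(x)\rangle$ against products $g_s\overline{g_t}$. Using the Parseval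
identity twice, these integrals determine the functions a.e.
(`IsParsevalDeterminingSet.inner_ae_eq`). So a unitary equivalence class amounts to the a.e. class
of the fiberwise Gram matrices. Parseval also gives $\int_{Y\times I}|\langle
v,M_{g_t}\varphi_i\rangle|^2=\int_X\sum_i|\langle v(x),\varphi_i(x)\rangle|^2d\mu$, so the system is
Bessel iff almost all fibers are Bessel with a common bound. The Gramians then form a bounded field,
whose direct integral determines its fibers a.e. This gives a well-defined injective map. For
surjectivity (`PosIntegrableMIOperator.exists_family`), the vectors $\mathrm{Gr}(x)^{1/2}\delta_i$
have the right Gram matrix but lie in $\ell^2(I)$. Gram–Schmidt coefficients depend measurably on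
the Gram matrix alone, so replacing the Gram–Schmidt vectors by a fixed orthonormal sequence of
$\mathcal H$ yields measurable fields in $\mathcal H$ (`exists_stronglyMeasurable_family`). The rank
bound ensures that the sequence is long enough, and integrability of the diagonal puts the fields in
$L^2$. -/

/-! ### Unitary equivalence and Gram kernels -/

section HilbertSpace

variable {S : Type*} {K K' : Type*}
  [NormedAddCommGroup K] [InnerProductSpace ℂ K]
  [NormedAddCommGroup K'] [InnerProductSpace ℂ K']

/-- A unitary equivalence of systems preserves the Gram kernel. -/
theorem UnitarilyEquivalent.inner_eq {u : S → K} {u' : S → K'} (h : UnitarilyEquivalent u u')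
    (s t : S) : ⟪u s, u t⟫_ℂ = ⟪u' s, u' t⟫_ℂ := by
  obtain ⟨U, hU⟩ := h
  have := U.inner_map_map ⟨u s, mem_closedSpan u s⟩ ⟨u t, mem_closedSpan u t⟩
  rw [hU, hU] at this
  exact this.symm

/-- The synthesis map of a system on finitely supported coefficients, with values in its closed
linear span. -/
noncomputable def spanSynthesis (u : S → K) : (S →₀ ℂ) →ₗ[ℂ] closedSpan u :=
  Finsupp.linearCombination ℂ fun s => ⟨u s, mem_closedSpan u s⟩

theorem coe_spanSynthesis (u : S → K) (c : S →₀ ℂ) :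
    (spanSynthesis u c : K) = Finsupp.linearCombination ℂ u c := by
  simp [spanSynthesis, Finsupp.linearCombination_apply, Finsupp.sum]

theorem denseRange_spanSynthesis (u : S → K) : DenseRange (spanSynthesis u) := by
  rw [DenseRange, Subtype.dense_iff]
  intro x hx
  have hx' : x ∈ closure (Submodule.span ℂ (Set.range u) : Set K) := hx
  refine closure_mono ?_ hx'
  rintro y hy
  rw [SetLike.mem_coe, Finsupp.mem_span_range_iff_exists_finsupp] at hy
  obtain ⟨c, rfl⟩ := hy
  exact ⟨_, ⟨c, rfl⟩, coe_spanSynthesis u c⟩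

theorem inner_linearCombination (u : S → K) (c d : S →₀ ℂ) :
    ⟪Finsupp.linearCombination ℂ u c, Finsupp.linearCombination ℂ u d⟫_ℂ =
      ∑ s ∈ c.support, ∑ t ∈ d.support, (starRingEnd ℂ) (c s) * (d t * ⟪u s, u t⟫_ℂ) := by
  simp only [Finsupp.linearCombination_apply, Finsupp.sum, sum_inner, inner_sum, inner_smul_left,
    inner_smul_right]
  rw [Finset.sum_comm]
  simp only [Finset.mul_sum]
  exact Finset.sum_congr rfl fun t _ => Finset.sum_congr rfl fun s _ => by ring

/-- Systems in Hilbert spaces with the same Gram kernel are unitarily equivalent. -/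
theorem unitarilyEquivalent_of_inner_eq [CompleteSpace K] [CompleteSpace K'] {u : S → K}
    {u' : S → K'} (h : ∀ s t, ⟪u s, u t⟫_ℂ = ⟪u' s, u' t⟫_ℂ) : UnitarilyEquivalent u u' := by
  have : CompleteSpace (closedSpan u) :=
    (Submodule.isClosed_topologicalClosure _).completeSpace_coe
  have : CompleteSpace (closedSpan u') :=
    (Submodule.isClosed_topologicalClosure _).completeSpace_coe
  -- The norm of a finite combination depends only on the Gram kernel, so matching coefficients is
  -- isometric between dense subspaces and extends by completeness.
  have hn : ∀ c : S →₀ ℂ, ‖spanSynthesis u' (LinearEquiv.refl ℂ _ c)‖ = ‖spanSynthesis u c‖ := by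
    intro c
    rw [Submodule.coe_norm, Submodule.coe_norm, coe_spanSynthesis, coe_spanSynthesis,
      @norm_eq_sqrt_re_inner ℂ, @norm_eq_sqrt_re_inner ℂ, LinearEquiv.refl_apply,
      inner_linearCombination, inner_linearCombination]
    simp only [h]
  refine ⟨(LinearEquiv.refl ℂ (S →₀ ℂ)).extendOfIsometry (spanSynthesis u) (spanSynthesis u')
    (denseRange_spanSynthesis u) (denseRange_spanSynthesis u') hn, fun s => ?_⟩
  have := LinearEquiv.extendOfIsometry_eq (LinearEquiv.refl ℂ (S →₀ ℂ)) (spanSynthesis u)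
    (spanSynthesis u') (denseRange_spanSynthesis u) (denseRange_spanSynthesis u') hn
    (Finsupp.single s 1)
  simpa [spanSynthesis] using this

end HilbertSpace

/-! ### Coordinates and matrices on $\ell^2(I)$ -/

section EllTwo

variable {I : Type*}

theorem inner_ellTwoDelta_left (i : I) (v : EllTwo I) : ⟪ellTwoDelta i, v⟫_ℂ = v i := by
  classical
  rw [ellTwoDelta, lp.inner_single_left]
  simp

theorem hasSum_ellTwoDelta (v : EllTwo I) : HasSum (fun i => v i • ellTwoDelta i) v := by
  let _ : DecidableEq I := Classical.decEq I
  convert lp.hasSum_single (p := 2) (by norm_num) v using 2 with i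
  rw [ellTwoDelta, ← lp.single_smul]
  simp

theorem ellTwo_norm_sq (v : EllTwo I) : HasSum (fun i => ‖v i‖ ^ 2) (‖v‖ ^ 2) := by
  have := lp.hasSum_norm (p := 2) (by norm_num) v
  simpa using this

theorem dense_span_ellTwoDelta :
    Dense (Submodule.span ℂ (Set.range (ellTwoDelta : I → EllTwo I)) : Set (EllTwo I)) := by
  intro v
  refine mem_closure_of_tendsto (hasSum_ellTwoDelta v) (Filter.Eventually.of_forall fun F => ?_)
  exact Submodule.sum_mem _ fun i _ =>
    Submodule.smul_mem _ _ (Submodule.subset_span (Set.mem_range_self i))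

instance [Countable I] : TopologicalSpace.SeparableSpace (EllTwo I) := by
  have h : TopologicalSpace.IsSeparable
      (Submodule.span ℂ (Set.range (ellTwoDelta : I → EllTwo I)) : Set (EllTwo I)) :=
    (Set.countable_range _).isSeparable.span
  rw [← TopologicalSpace.isSeparable_univ_iff, ← dense_span_ellTwoDelta.closure_eq]
  exact h.closure

/-- A bounded operator on `ℓ²(I)` is determined by its matrix. -/
theorem ellTwo_clm_ext {A B : EllTwo I →L[ℂ] EllTwo I}
    (h : ∀ i j, ⟪ellTwoDelta i, A (ellTwoDelta j)⟫_ℂ = ⟪ellTwoDelta i, B (ellTwoDelta j)⟫_ℂ) :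
    A = B := by
  refine ContinuousLinearMap.ext_on dense_span_ellTwoDelta ?_
  rintro _ ⟨j, rfl⟩
  refine lp.ext (funext fun i => ?_)
  rw [← inner_ellTwoDelta_left, ← inner_ellTwoDelta_left, h]

end EllTwo

/-! ### Gramians of Bessel families -/

section Gramian

variable {I : Type*} {K : Type*} [NormedAddCommGroup K] [InnerProductSpace ℂ K]

/-- The analysis operator of a Bessel family. -/
theorem exists_analysisOperator {u : I → K} {B : ℝ} (hB : 0 ≤ B)
    (h : ∀ (F : Finset I) (v : K), ∑ i ∈ F, ‖⟪u i, v⟫_ℂ‖ ^ 2 ≤ B * ‖v‖ ^ 2) :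
    ∃ T : K →L[ℂ] EllTwo I, (∀ v i, T v i = ⟪u i, v⟫_ℂ) ∧ ‖T‖ ≤ √B := by
  have hm : ∀ v : K, Memℓp (fun i => ⟪u i, v⟫_ℂ) 2 := fun v =>
    memℓp_gen' (C := B * ‖v‖ ^ 2) fun F => by simpa using h F v
  let T₀ : K →ₗ[ℂ] EllTwo I :=
    { toFun := fun v => ⟨fun i => ⟪u i, v⟫_ℂ, hm v⟩
      map_add' := fun v w => lp.ext (funext fun i => inner_add_right _ _ _)
      map_smul' := fun c v => lp.ext (funext fun i => inner_smul_right _ _ _) }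
  have hT : ∀ v, ‖T₀ v‖ ≤ √B * ‖v‖ := by
    intro v
    refine abs_le_of_sq_le_sq' ?_ (by positivity) |>.2
    rw [mul_pow, Real.sq_sqrt hB]
    exact hasSum_le_of_sum_le (ellTwo_norm_sq (T₀ v)) fun F => h F v
  exact ⟨T₀.mkContinuous _ hT, fun _ _ => rfl, T₀.mkContinuous_norm_le (Real.sqrt_nonneg B) hT⟩

variable [CompleteSpace K]

theorem adjoint_analysis_delta {u : I → K} {T : K →L[ℂ] EllTwo I}
    (hT : ∀ v i, T v i = ⟪u i, v⟫_ℂ) (i : I) :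
    ContinuousLinearMap.adjoint T (ellTwoDelta i) = u i := by
  refine ext_inner_right ℂ fun v => ?_
  rw [ContinuousLinearMap.adjoint_inner_left, inner_ellTwoDelta_left, hT]

theorem IsGramian.inner_delta {u : I → K} {G : EllTwo I →L[ℂ] EllTwo I} (h : IsGramian u G)
    (i j : I) : ⟪ellTwoDelta i, G (ellTwoDelta j)⟫_ℂ = ⟪u i, u j⟫_ℂ := by
  obtain ⟨T, hT, rfl⟩ := h
  rw [ContinuousLinearMap.comp_apply, adjoint_analysis_delta hT, inner_ellTwoDelta_left, hT]

theorem IsGramian.isPositive {u : I → K} {G : EllTwo I →L[ℂ] EllTwo I} (h : IsGramian u G) :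
    G.IsPositive := by
  obtain ⟨T, hT, rfl⟩ := h
  exact ContinuousLinearMap.isPositive_self_comp_adjoint T

/-- A family whose Gram matrix is the matrix of a bounded operator is Bessel, with that operator as
its Gramian. -/
theorem isGramian_of_inner_eq {u : I → K} {G : EllTwo I →L[ℂ] EllTwo I}
    (h : ∀ i j, ⟪ellTwoDelta i, G (ellTwoDelta j)⟫_ℂ = ⟪u i, u j⟫_ℂ) :
    IsGramian u G ∧
      ∀ (F : Finset I) (v : K), ∑ i ∈ F, ‖⟪u i, v⟫_ℂ‖ ^ 2 ≤ ‖G‖ * ‖v‖ ^ 2 := by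
  have hF : ∀ (F : Finset I) (v : K), ∑ i ∈ F, ‖⟪u i, v⟫_ℂ‖ ^ 2 ≤ ‖G‖ * ‖v‖ ^ 2 := by
    intro F v
    let _ : DecidableEq I := Classical.decEq I
    -- The bound follows from $N=\langle w,v\rangle\le\|w\|\|v\|$ and $\|w\|^2=\langle
    -- d,Gd\rangle\le\|G\|N$, by squaring and cancelling $N$.
    set N : ℝ := ∑ i ∈ F, ‖⟪u i, v⟫_ℂ‖ ^ 2 with hN
    set w : K := ∑ i ∈ F, ⟪u i, v⟫_ℂ • u i with hw
    set d : EllTwo I := ∑ i ∈ F, ⟪u i, v⟫_ℂ • ellTwoDelta i with hd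
    have hN0 : 0 ≤ N := Finset.sum_nonneg fun i _ => by positivity
    have hwv : ⟪w, v⟫_ℂ = (N : ℂ) := by
      simp only [hw, sum_inner, inner_smul_left, hN]
      push_cast
      exact Finset.sum_congr rfl fun i _ => by rw [RCLike.conj_mul]; rfl
    have hww : ⟪w, w⟫_ℂ = ⟪d, G d⟫_ℂ := by
      simp only [hw, hd, map_sum, map_smul, sum_inner, inner_sum, inner_smul_left,
        inner_smul_right, h]
    have hdd : ‖d‖ ^ 2 = N := by
      have h1 : ⟪d, d⟫_ℂ = (N : ℂ) := by
        conv_lhs => enter [2]; rw [hd]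
        simp only [sum_inner, inner_smul_left, hN, inner_ellTwoDelta_left]
        push_cast
        refine Finset.sum_congr rfl fun i hi => ?_
        have : d i = ⟪u i, v⟫_ℂ := by
          rw [← inner_ellTwoDelta_left, hd]
          simp only [inner_sum, inner_smul_right, inner_ellTwoDelta_left]
          rw [Finset.sum_eq_single i]
          · rw [ellTwoDelta, lp.single_apply_self, mul_one]
          · intro j _ hji
            rw [ellTwoDelta, lp.single_apply_ne _ _ _ hji.symm, mul_zero]
          · exact fun h => absurd hi h
        rw [this, RCLike.conj_mul]
        rfl
      rw [inner_self_eq_norm_sq_to_K] at h1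
      exact Complex.ofReal_injective (by simpa using h1)
    have h2 : ‖w‖ ^ 2 ≤ ‖G‖ * N := by
      have h5 : ‖w‖ ^ 2 = ‖⟪w, w⟫_ℂ‖ := by rw [inner_self_eq_norm_sq_to_K]; simp
      rw [h5, hww, ← hdd]
      calc ‖⟪d, G d⟫_ℂ‖ ≤ ‖d‖ * ‖G d‖ := norm_inner_le_norm _ _
        _ ≤ ‖d‖ * (‖G‖ * ‖d‖) := by gcongr; exact G.le_opNorm d
        _ = ‖G‖ * ‖d‖ ^ 2 := by ring
    have h3 : N ≤ ‖w‖ * ‖v‖ := by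
      have := norm_inner_le_norm (𝕜 := ℂ) w v
      rwa [hwv, Complex.norm_real, Real.norm_of_nonneg hN0] at this
    rcases hN0.eq_or_lt with h0 | h0
    · rw [← h0]; positivity
    · have h4 : N * N ≤ N * (‖G‖ * ‖v‖ ^ 2) := by
        calc N * N ≤ (‖w‖ * ‖v‖) * (‖w‖ * ‖v‖) := by gcongr
          _ = ‖w‖ ^ 2 * ‖v‖ ^ 2 := by ring
          _ ≤ (‖G‖ * N) * ‖v‖ ^ 2 := by gcongr
          _ = N * (‖G‖ * ‖v‖ ^ 2) := by ring
      exact le_of_mul_le_mul_left h4 h0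
  refine ⟨?_, hF⟩
  obtain ⟨T, hT, -⟩ := exists_analysisOperator (norm_nonneg G) hF
  refine ⟨T, hT, ellTwo_clm_ext fun i j => ?_⟩
  rw [h, IsGramian.inner_delta ⟨T, hT, rfl⟩]

theorem IsGramian.congr {u u' : I → K} {G G' : EllTwo I →L[ℂ] EllTwo I} (h : IsGramian u G)
    (h' : IsGramian u' G') (e : ∀ i j, ⟪u i, u j⟫_ℂ = ⟪u' i, u' j⟫_ℂ) : G = G' :=
  ellTwo_clm_ext fun i j => by rw [h.inner_delta, h'.inner_delta, e]

/-- The range of $TT^*$ lies in that of $T$, which is closed when `K` is finite-dimensional;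
otherwise the bound is $\infty$. -/
theorem IsGramian.operatorRank_le {u : I → K} {G : EllTwo I →L[ℂ] EllTwo I}
    (h : IsGramian u G) : operatorRank G ≤ hilbertDim K := by
  obtain ⟨T, hT, rfl⟩ := h
  rw [hilbertDim]
  rcases lt_or_ge (Module.rank ℂ K) Cardinal.aleph0 with hK | hK
  · have : FiniteDimensional ℂ K := Module.rank_lt_aleph0_iff.1 hK
    rw [operatorRank, hilbertDim]
    have hle : (LinearMap.range
        ((T ∘L ContinuousLinearMap.adjoint T : EllTwo I →L[ℂ] EllTwo I) :
          EllTwo I →ₗ[ℂ] EllTwo I)).topologicalClosure ≤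
        LinearMap.range (T : K →ₗ[ℂ] EllTwo I) := by
      refine Submodule.topologicalClosure_minimal _ ?_ (Submodule.closed_of_finiteDimensional _)
      rintro _ ⟨x, rfl⟩
      exact ⟨ContinuousLinearMap.adjoint T x, rfl⟩
    have h1 := Submodule.rank_mono hle
    have h2 := lift_rank_range_le (T : K →ₗ[ℂ] EllTwo I)
    refine (Cardinal.toENat.monotone' h1).trans ?_
    have h3 := Cardinal.toENat.monotone' h2
    simpa using h3
  · rw [Cardinal.toENat_eq_top.2 hK]
    exact le_top

/-- A positive operator on a Hilbert space has a self-adjoint square root. -/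
theorem exists_sqrt_of_isPositive {G : K →L[ℂ] K} (hG : G.IsPositive) :
    ∃ Q : K →L[ℂ] K, ContinuousLinearMap.adjoint Q = Q ∧ Q * Q = G := by
  have hG0 : 0 ≤ G := (ContinuousLinearMap.nonneg_iff_isPositive G).2 hG
  exact ⟨CFC.sqrt G, (IsSelfAdjoint.of_nonneg (CFC.sqrt_nonneg G)).adjoint_eq,
    CFC.sqrt_mul_sqrt_self G hG0⟩

/-- A positive operator on `ℓ²(I)` is the Gram matrix of a family in the closure of its range. -/
theorem exists_family_of_isPositive {G : EllTwo I →L[ℂ] EllTwo I} (hG : G.IsPositive) :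
    ∃ a : I → EllTwo I, (∀ i j, ⟪a i, a j⟫_ℂ = ⟪ellTwoDelta i, G (ellTwoDelta j)⟫_ℂ) ∧
      ∀ i, a i ∈ (LinearMap.range (G : EllTwo I →ₗ[ℂ] EllTwo I)).topologicalClosure := by
  obtain ⟨Q, hQ, hQQ⟩ := exists_sqrt_of_isPositive hG
  have hin : ∀ v w, ⟪Q v, Q w⟫_ℂ = ⟪v, G w⟫_ℂ := by
    intro v w
    conv_lhs => rw [← hQ]
    rw [ContinuousLinearMap.adjoint_inner_left, hQ, ← hQQ]
    rfl
  refine ⟨fun i => Q (ellTwoDelta i), fun i j => hin _ _, fun i => ?_⟩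
  have hGadj : ContinuousLinearMap.adjoint G = G := hG.isSelfAdjoint.adjoint_eq
  -- As $G$ is self-adjoint, the closure of its range is $(\ker G)^\perp$, and $Gv=0$ forces
  -- $\|Qv\|^2=\langle v,Gv\rangle=0$.
  have := ContinuousLinearMap.orthogonal_ker G
  rw [hGadj] at this
  rw [← this, Submodule.mem_orthogonal]
  intro v hv
  have hv' : G v = 0 := hv
  have hQv : Q v = 0 := by
    rw [← inner_self_eq_zero (𝕜 := ℂ), hin, hv', inner_zero_right]
  rw [← hQ, ContinuousLinearMap.adjoint_inner_right, hQv, inner_zero_left]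

end Gramian

/-! ### Measurable transfer by Gram–Schmidt -/

section GramSchmidt

open InnerProductSpace

variable {K H : Type*} [NormedAddCommGroup K] [InnerProductSpace ℂ K]
  [NormedAddCommGroup H] [InnerProductSpace ℂ H]

open scoped Classical in
/-- The number of nonzero vectors among the first `j` Gram–Schmidt vectors of a sequence. -/
noncomputable def pivotCount (a : ℕ → K) (j : ℕ) : ℕ :=
  ∑ i ∈ Finset.range j, if gramSchmidt ℂ a i = 0 then 0 else 1

/-- The coefficient of the `n`-th vector of a sequence along its `j`-th normalized Gram–Schmidt
vector. -/
noncomputable def gramSchmidtCoeff (a : ℕ → K) (j n : ℕ) : ℂ :=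
  ⟪gramSchmidtNormed ℂ a j, a n⟫_ℂ

/-- The copy of a sequence obtained by replacing its nonzero normalized Gram–Schmidt vectors by
consecutive terms of the sequence `b`. -/
noncomputable def gramSchmidtTransfer (a : ℕ → K) (b : ℕ → H) (n : ℕ) : H :=
  ∑ j ∈ Finset.range (n + 1), gramSchmidtCoeff a j n • b (pivotCount a j)

theorem gramSchmidtCoeff_eq (a : ℕ → K) (j n : ℕ) :
    gramSchmidtCoeff a j n = (‖gramSchmidt ℂ a j‖ : ℂ)⁻¹ * ⟪gramSchmidt ℂ a j, a n⟫_ℂ := by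
  rw [gramSchmidtCoeff, gramSchmidtNormed, inner_smul_left]
  simp

theorem gramSchmidtCoeff_eq_zero {a : ℕ → K} {j : ℕ} (h : gramSchmidt ℂ a j = 0) (n : ℕ) :
    gramSchmidtCoeff a j n = 0 := by
  rw [gramSchmidtCoeff_eq, h, inner_zero_left, mul_zero]

/-- `a n` differs from its Gram–Schmidt vector by a combination of earlier, orthogonal ones. -/
theorem norm_sq_gramSchmidt (a : ℕ → K) (n : ℕ) :
    ⟪gramSchmidt ℂ a n, a n⟫_ℂ = (‖gramSchmidt ℂ a n‖ : ℂ) ^ 2 := by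
  conv_lhs => rw [gramSchmidt_def'' ℂ a n]
  rw [inner_add_right, inner_sum, Finset.sum_eq_zero, add_zero, inner_self_eq_norm_sq_to_K]
  · rfl
  · intro i hi
    rw [inner_smul_right, gramSchmidt_orthogonal ℂ a (Finset.mem_Iio.1 hi).ne', mul_zero]

theorem eq_sum_gramSchmidtNormed (a : ℕ → K) (n : ℕ) :
    a n = ∑ j ∈ Finset.range (n + 1), gramSchmidtCoeff a j n • gramSchmidtNormed ℂ a j := by
  have hterm : ∀ j, gramSchmidtCoeff a j n • gramSchmidtNormed ℂ a j =
      (⟪gramSchmidt ℂ a j, a n⟫_ℂ / (‖gramSchmidt ℂ a j‖ : ℂ) ^ 2) • gramSchmidt ℂ a j := by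
    intro j
    rw [gramSchmidtCoeff_eq, gramSchmidtNormed, smul_smul]
    congr 1
    simp only [Complex.coe_algebraMap, div_eq_mul_inv, sq, mul_inv]
    ring
  simp only [hterm]
  rw [Finset.sum_range_succ, norm_sq_gramSchmidt]
  conv_lhs => rw [gramSchmidt_def'' ℂ a n]
  rw [add_comm]
  congr 1
  · refine Finset.sum_congr ?_ fun _ _ => rfl
    ext; simp
  · by_cases h : gramSchmidt ℂ a n = 0
    · simp [h]
    · rw [div_self (pow_ne_zero _ (by simpa using h)), one_smul]

/-- Both sequences have the same coefficients along orthonormal vectors. Vanishing Gram–Schmidt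
vectors have coefficient zero, so orthonormality of `b` matters only at pivots. -/
theorem inner_gramSchmidtTransfer {a : ℕ → K} {b : ℕ → H}
    (h : ∀ j k, gramSchmidt ℂ a j ≠ 0 → gramSchmidt ℂ a k ≠ 0 →
      ⟪b (pivotCount a j), b (pivotCount a k)⟫_ℂ = if j = k then 1 else 0) (n m : ℕ) :
    ⟪gramSchmidtTransfer a b n, gramSchmidtTransfer a b m⟫_ℂ = ⟪a n, a m⟫_ℂ := by
  conv_rhs => rw [eq_sum_gramSchmidtNormed a n, eq_sum_gramSchmidtNormed a m]
  simp only [gramSchmidtTransfer, sum_inner, inner_sum, inner_smul_left, inner_smul_right]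
  refine Finset.sum_congr rfl fun k _ => ?_
  by_cases hk : gramSchmidt ℂ a k = 0
  · simp [gramSchmidtCoeff_eq_zero hk]
  congr 1
  refine Finset.sum_congr rfl fun j _ => ?_
  by_cases hj : gramSchmidt ℂ a j = 0
  · simp [gramSchmidtCoeff_eq_zero hj]
  congr 1
  rw [h j k hj hk]
  split_ifs with hjk
  · subst hjk
    rw [inner_self_eq_norm_sq_to_K, gramSchmidtNormed_unit_length']
    · simp
    · simpa [gramSchmidtNormed] using hj
  · simp [gramSchmidtNormed, inner_smul_left, inner_smul_right, gramSchmidt_orthogonal ℂ a hjk]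

theorem pivotCount_lt_pivotCount {a : ℕ → K} {j k : ℕ} (hj : gramSchmidt ℂ a j ≠ 0)
    (hjk : j < k) : pivotCount a j < pivotCount a k := by
  have h1 : pivotCount a j < pivotCount a (j + 1) := by
    rw [pivotCount, pivotCount, Finset.sum_range_succ, if_neg hj]
    exact Nat.lt_succ_self _
  refine h1.trans_le (Finset.sum_le_sum_of_subset ?_)
  exact Finset.range_mono hjk

theorem pivotCount_inj {a : ℕ → K} {j k : ℕ} (hj : gramSchmidt ℂ a j ≠ 0)
    (hk : gramSchmidt ℂ a k ≠ 0) : pivotCount a j = pivotCount a k ↔ j = k := by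
  refine ⟨fun h => ?_, fun h => h ▸ rfl⟩
  rcases lt_trichotomy j k with hjk | hjk | hjk
  · exact absurd h (pivotCount_lt_pivotCount hj hjk).ne
  · exact hjk
  · exact absurd h (pivotCount_lt_pivotCount hk hjk).ne'

/-- The number of nonzero Gram–Schmidt vectors is at most the dimension of a subspace containing
the sequence. -/
theorem pivotCount_lt_hilbertDim {a : ℕ → K} {V : Submodule ℂ K} (hV : ∀ n, a n ∈ V) {j : ℕ}
    (hj : gramSchmidt ℂ a j ≠ 0) : (pivotCount a j : ℕ∞) < hilbertDim V := by
  classical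
  -- The pivot `j` itself is counted in `s`, which makes the final inequality strict.
  let s : Finset ℕ := (Finset.range (j + 1)).filter fun i => gramSchmidt ℂ a i ≠ 0
  have hcard : s.card = pivotCount a j + 1 := by
    rw [Finset.card_filter, pivotCount, Finset.sum_range_succ, if_pos hj]
    congr 1
    refine Finset.sum_congr rfl fun i _ => ?_
    by_cases h : gramSchmidt ℂ a i = 0 <;> simp [h]
  have hmem : ∀ i, gramSchmidt ℂ a i ∈ V := fun i =>
    (Submodule.span_le.2 (by rintro _ ⟨k, -, rfl⟩; exact hV k))
      (gramSchmidt_mem_span ℂ a (le_refl i))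
  have hli : LinearIndependent ℂ (fun i : s => (⟨gramSchmidt ℂ a i, hmem i⟩ : V)) := by
    refine linearIndependent_of_ne_zero_of_inner_eq_zero (fun i h => ?_) fun i k hik => ?_
    · exact (Finset.mem_filter.1 i.2).2 (congrArg Subtype.val h)
    · exact gramSchmidt_orthogonal ℂ a fun h => hik (Subtype.ext h)
  have h1 := hli.cardinal_lift_le_rank
  have h2 := Cardinal.toENat.monotone' h1
  have h3 : ((pivotCount a j + 1 : ℕ) : ℕ∞) ≤ hilbertDim V := by
    rw [← hcard, hilbertDim]
    simpa using h2
  refine lt_of_lt_of_le ?_ h3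
  exact_mod_cast Nat.lt_succ_self _

/-- Every complex inner product space has a sequence whose first `dim H` terms are
orthonormal. -/
theorem exists_orthonormal_sequence (H : Type*) [NormedAddCommGroup H] [InnerProductSpace ℂ H] :
    ∃ b : ℕ → H, ∀ n m : ℕ, (n : ℕ∞) < hilbertDim H → (m : ℕ∞) < hilbertDim H →
      ⟪b n, b m⟫_ℂ = if n = m then 1 else 0 := by
  by_cases hfin : FiniteDimensional ℂ H
  · let e := stdOrthonormalBasis ℂ H
    refine ⟨fun n => if h : n < Module.finrank ℂ H then e ⟨n, h⟩ else 0, fun n m hn hm => ?_⟩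
    have hd : hilbertDim H = Module.finrank ℂ H := by
      rw [hilbertDim, ← Module.finrank_eq_rank]
      simp
    rw [hd] at hn hm
    have hn' : n < Module.finrank ℂ H := by exact_mod_cast hn
    have hm' : m < Module.finrank ℂ H := by exact_mod_cast hm
    simp only [dif_pos hn', dif_pos hm']
    rw [orthonormal_iff_ite.1 e.orthonormal]
    simp
  · have hr : Cardinal.aleph0 ≤ Module.rank ℂ H := by
      rw [← not_lt, Module.rank_lt_aleph0_iff]
      exact hfin
    let B := Module.Basis.ofVectorSpace ℂ H
    have hinf : Infinite (Module.Basis.ofVectorSpaceIndex ℂ H) := by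
      rw [Cardinal.infinite_iff, B.mk_eq_rank'']
      exact hr
    -- Only an independent sequence is needed, so an algebraic basis suffices.
    let f : ℕ → H := fun n => B (Infinite.natEmbedding _ n)
    have hf : LinearIndependent ℂ f :=
      B.linearIndependent.comp _ (Infinite.natEmbedding _).injective
    exact ⟨gramSchmidtNormed ℂ f, fun n m _ _ =>
      orthonormal_iff_ite.1 (gramSchmidtNormed_orthonormal hf) n m⟩

variable {X : Type*} [MeasurableSpace X] {a : X → ℕ → K}

/-- The Gram–Schmidt recursion, paired with `a x n`, involves only the Gram kernel and earlier such
pairings. No measurability of `a` itself is needed. -/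
theorem measurable_inner_gramSchmidt (ha : ∀ n m, Measurable fun x => ⟪a x n, a x m⟫_ℂ) (k : ℕ) :
    ∀ n, Measurable fun x => ⟪gramSchmidt ℂ (a x) k, a x n⟫_ℂ := by
  induction k using Nat.strong_induction_on with
  | _ k ih =>
    intro n
    have h : ∀ x, ⟪gramSchmidt ℂ (a x) k, a x n⟫_ℂ = ⟪a x k, a x n⟫_ℂ -
        ∑ i ∈ Finset.range k, (starRingEnd ℂ)
          (⟪gramSchmidt ℂ (a x) i, a x k⟫_ℂ / ⟪gramSchmidt ℂ (a x) i, a x i⟫_ℂ) *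
            ⟪gramSchmidt ℂ (a x) i, a x n⟫_ℂ := by
      intro x
      have h1 := gramSchmidt_def'' ℂ (a x) k
      rw [← Nat.Iio_eq_range, eq_sub_iff_add_eq]
      conv_rhs => rw [h1]
      rw [inner_add_left, sum_inner]
      congr 1
      refine Finset.sum_congr rfl fun i _ => ?_
      rw [inner_smul_left, norm_sq_gramSchmidt]
      rfl
    simp only [h]
    refine (ha k n).sub (Finset.measurable_sum _ fun i hi => ?_)
    have hi' := Finset.mem_range.1 hi
    exact (Complex.continuous_conj.measurable.comp
      ((ih i hi' k).div (ih i hi' i))).mul (ih i hi' n)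

theorem measurable_gramSchmidtCoeff (ha : ∀ n m, Measurable fun x => ⟪a x n, a x m⟫_ℂ)
    (j n : ℕ) : Measurable fun x => gramSchmidtCoeff (a x) j n := by
  have h : ∀ x, gramSchmidtCoeff (a x) j n =
      ((√‖⟪gramSchmidt ℂ (a x) j, a x j⟫_ℂ‖ : ℝ) : ℂ)⁻¹ * ⟪gramSchmidt ℂ (a x) j, a x n⟫_ℂ := by
    intro x
    rw [gramSchmidtCoeff_eq, norm_sq_gramSchmidt]
    congr 3
    simp
  simp only [h]
  have h1 := measurable_inner_gramSchmidt ha j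
  exact ((Complex.measurable_ofReal.comp (h1 j).norm.sqrt).inv).mul (h1 n)

theorem measurable_pivotCount (ha : ∀ n m, Measurable fun x => ⟪a x n, a x m⟫_ℂ)
    (j : ℕ) : Measurable fun x => pivotCount (a x) j := by
  classical
  unfold pivotCount
  refine Finset.measurable_sum _ fun i _ => Measurable.ite ?_ measurable_const measurable_const
  have h : {x | gramSchmidt ℂ (a x) i = 0} =
      (fun x => ⟪gramSchmidt ℂ (a x) i, a x i⟫_ℂ) ⁻¹' {0} := by
    ext x
    simp [norm_sq_gramSchmidt]
  rw [h]
  exact measurable_inner_gramSchmidt ha i i (measurableSet_singleton 0)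

theorem stronglyMeasurable_gramSchmidtTransfer
    (ha : ∀ n m, Measurable fun x => ⟪a x n, a x m⟫_ℂ) (b : ℕ → H) (n : ℕ) :
    StronglyMeasurable fun x => gramSchmidtTransfer (a x) b n := by
  unfold gramSchmidtTransfer
  refine Finset.stronglyMeasurable_fun_sum _ fun j _ => ?_
  refine (measurable_gramSchmidtCoeff ha j n).stronglyMeasurable.smul ?_
  exact (StronglyMeasurable.of_discrete (f := b)).comp_measurable (measurable_pivotCount ha j)

end GramSchmidt

/-- A measurable positive definite kernel of rank at most `dim H` on a countable set is
the Gram kernel of measurable vector fields in `H`. -/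
theorem exists_stronglyMeasurable_family {X : Type*} [MeasurableSpace X] {I : Type*} [Countable I]
    {K H : Type*} [NormedAddCommGroup K] [InnerProductSpace ℂ K]
    [NormedAddCommGroup H] [InnerProductSpace ℂ H] {a : X → I → K}
    (ha : ∀ i j, Measurable fun x => ⟪a x i, a x j⟫_ℂ) :
    ∃ φ : I → X → H, (∀ i, StronglyMeasurable (φ i)) ∧
      ∀ x (V : Submodule ℂ K), (∀ i, a x i ∈ V) → hilbertDim V ≤ hilbertDim H →
        ∀ i j, ⟪φ i x, φ j x⟫_ℂ = ⟪a x i, a x j⟫_ℂ := by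
  classical
  let _ := Encodable.ofCountable I
  -- Integers that encode no index are padded with the zero vector, which lies in every subspace.
  let a' : X → ℕ → K := fun x n => (Encodable.decode₂ I n).elim 0 (a x)
  have ha' : ∀ n m, Measurable fun x => ⟪a' x n, a' x m⟫_ℂ := by
    intro n m
    rcases hn : Encodable.decode₂ I n with _ | i
    · simp [a', hn]
    rcases hm : Encodable.decode₂ I m with _ | j
    · simp [a', hm]
    simpa [a', hn, hm] using ha i j
  obtain ⟨b, hb⟩ := exists_orthonormal_sequence H
  refine ⟨fun i x => gramSchmidtTransfer (a' x) b (Encodable.encode i),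
    fun i => stronglyMeasurable_gramSchmidtTransfer ha' b _, fun x V hV hdim i j => ?_⟩
  have hV' : ∀ n, a' x n ∈ V := by
    intro n
    rcases hn : Encodable.decode₂ I n with _ | i
    · simp [a', hn]
    · simpa [a', hn] using hV i
  rw [inner_gramSchmidtTransfer]
  · simp [a']
  · intro j k hj hk
    rw [hb _ _ ((pivotCount_lt_hilbertDim hV' hj).trans_le hdim)
      ((pivotCount_lt_hilbertDim hV' hk).trans_le hdim)]
    simp only [pivotCount_inj hj hk]

/-! ### Direct integrals and their fibers -/

section DirectIntegral

variable {X : Type*} [MeasurableSpace X] {μ : Measure X}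
  {K K' : Type*} [NormedAddCommGroup K] [InnerProductSpace ℂ K]
  [NormedAddCommGroup K'] [InnerProductSpace ℂ K']

theorem ellTwo_aestronglyMeasurable {I : Type*} [Countable I] {f : X → EllTwo I}
    (h : ∀ i, AEStronglyMeasurable (fun x => f x i) μ) : AEStronglyMeasurable f μ :=
  aestronglyMeasurable_of_tendsto_ae (Filter.atTop : Filter (Finset I))
    (f := fun F x => ∑ i ∈ F, f x i • ellTwoDelta i)
    (fun F => Finset.aestronglyMeasurable_fun_sum F fun i _ => (h i).smul_const _)
    (Filter.Eventually.of_forall fun x => hasSum_ellTwoDelta (f x))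

/-- Simple functions reduce to constants on sets; the general case is a limit, by continuity of each
`R x`. -/
theorem aestronglyMeasurable_field_apply {R : X → K →L[ℂ] K'}
    (hR : ∀ u, AEStronglyMeasurable (fun x => R x u) μ) {ψ : X → K}
    (hψ : AEStronglyMeasurable ψ μ) : AEStronglyMeasurable (fun x => R x (ψ x)) μ := by
  have hs : ∀ s : SimpleFunc X K, AEStronglyMeasurable (fun x => R x (s x)) μ := by
    intro s
    induction s using SimpleFunc.induction with
    | @const c s hs =>
      refine ((hR c).indicator hs).congr (Filter.Eventually.of_forall fun x => ?_)
      by_cases hx : x ∈ s <;> simp [hx]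
    | @add f g _ hf hg =>
      refine (hf.add hg).congr (Filter.Eventually.of_forall fun x => ?_)
      simp
  obtain ⟨ψ', hψ', he⟩ := hψ
  refine aestronglyMeasurable_of_tendsto_ae Filter.atTop (fun n => hs (hψ'.approx n)) ?_
  filter_upwards [he] with x hx
  rw [hx]
  exact ((R x).continuous.tendsto _).comp (hψ'.tendsto_approx x)

/-- An essentially bounded, strongly measurable field of operators has a direct integral. -/
theorem exists_directIntegral {R : X → K →L[ℂ] K'} {C : ℝ} (hC : ∀ᵐ x ∂μ, ‖R x‖ ≤ C)
    (hR : ∀ u, AEStronglyMeasurable (fun x => R x u) μ) :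
    ∃ T : Lp K 2 μ →L[ℂ] Lp K' 2 μ, ∀ ψ : Lp K 2 μ, T ψ =ᵐ[μ] fun x => R x (ψ x) := by
  have hb : ∀ ψ : Lp K 2 μ, ∀ᵐ x ∂μ, ‖R x (ψ x)‖ ≤ C * ‖ψ x‖ := fun ψ => by
    filter_upwards [hC] with x hx
    exact (R x).le_of_opNorm_le hx _
  have hm : ∀ ψ : Lp K 2 μ, MemLp (fun x => R x (ψ x)) 2 μ := fun ψ =>
    (Lp.memLp ψ).of_le_mul (aestronglyMeasurable_field_apply hR (Lp.aestronglyMeasurable ψ)) (hb ψ)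
  let T₀ : Lp K 2 μ →ₗ[ℂ] Lp K' 2 μ :=
    { toFun := fun ψ => (hm ψ).toLp _
      map_add' := fun ψ χ => by
        rw [← MemLp.toLp_add]
        refine MemLp.toLp_congr _ _ ?_
        filter_upwards [Lp.coeFn_add ψ χ] with x hx
        rw [hx, Pi.add_apply, map_add, Pi.add_apply]
      map_smul' := fun c ψ => by
        rw [RingHom.id_apply, ← MemLp.toLp_const_smul]
        refine MemLp.toLp_congr _ _ ?_
        filter_upwards [Lp.coeFn_smul c ψ] with x hx
        simp [hx] }
  have hT : ∀ ψ, T₀ ψ =ᵐ[μ] fun x => R x (ψ x) := fun ψ => (hm ψ).coeFn_toLp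
  refine ⟨T₀.mkContinuous C fun ψ => Lp.norm_le_mul_norm_of_ae_le_mul ?_, hT⟩
  filter_upwards [hT ψ, hb ψ] with x h1 h2
  rwa [h1]

theorem IsDirectIntegral.isMIOperator {T : Lp K 2 μ →L[ℂ] Lp K' 2 μ} {R : X → K →L[ℂ] K'}
    (h : IsDirectIntegral T R) : IsMIOperator T := by
  intro φ ψ
  refine Lp.ext ?_
  filter_upwards [h.apply_ae (mulOp φ ψ), h.apply_ae ψ, mulOp_coeFn φ ψ, mulOp_coeFn φ (T ψ)]
    with x h1 h2 h3 h4
  rw [h1, h3, h4, h2, map_smul]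

theorem IsDirectIntegral.isPositive {T : Lp K 2 μ →L[ℂ] Lp K 2 μ} {R : X → K →L[ℂ] K}
    (h : IsDirectIntegral T R) (hR : ∀ᵐ x ∂μ, (R x).IsPositive) : T.IsPositive := by
  rw [ContinuousLinearMap.isPositive_iff_complex]
  intro ψ
  -- The integrand is a.e. equal to its own norm, so the integral is visibly real and nonnegative.
  have h1 : ⟪T ψ, ψ⟫_ℂ = ((∫ x, ‖⟪R x (ψ x), ψ x⟫_ℂ‖ ∂μ : ℝ) : ℂ) := by
    rw [L2.inner_def, ← integral_complex_ofReal]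
    refine integral_congr_ae ?_
    filter_upwards [h.apply_ae ψ, hR] with x hx hp
    rw [hx]
    obtain ⟨h2, h3⟩ := (ContinuousLinearMap.isPositive_iff_complex _).1 hp (ψ x)
    conv_rhs => rw [← h2]
    rw [Complex.norm_real, Real.norm_of_nonneg h3]
    exact h2.symm
  rw [h1]
  refine ⟨by simp, ?_⟩
  simpa using integral_nonneg fun x => norm_nonneg ⟪R x (ψ x), ψ x⟫_ℂ

/-- The fibers of a direct integral are determined by the operator. -/
theorem IsDirectIntegral.ae_eq [SigmaFinite μ] [TopologicalSpace.SeparableSpace K]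
    {T : Lp K 2 μ →L[ℂ] Lp K' 2 μ} {R R' : X → K →L[ℂ] K'}
    (h : IsDirectIntegral T R) (h' : IsDirectIntegral T R') : R =ᵐ[μ] R' := by
  have hu : ∀ u : K, ∀ᵐ x ∂μ, R x u = R' x u := by
    intro u
    -- Test on $1_su$ with `s` of finite measure; a countable dense set of `u` then leaves a single
    -- null set.
    refine ae_of_forall_measure_lt_top_ae_restrict _ fun s hs hμs => ?_
    rw [ae_restrict_iff' hs]
    filter_upwards [h.apply_ae (indicatorConstLp 2 hs hμs.ne u),
      h'.apply_ae (indicatorConstLp 2 hs hμs.ne u),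
      indicatorConstLp_coeFn (p := 2) (hs := hs) (hμs := hμs.ne) (c := u)] with x h1 h2 h3 hx
    rw [h1, h3, Set.indicator_of_mem hx] at h2
    exact h2
  filter_upwards [ae_all_iff.2 fun n => hu (TopologicalSpace.denseSeq K n)] with x hx
  refine ContinuousLinearMap.coeFn_injective ?_
  refine (TopologicalSpace.denseRange_denseSeq K).equalizer (R x).continuous (R' x).continuous ?_
  exact funext hx

/-- The fibers of a positive direct integral are positive. -/
theorem IsDirectIntegral.ae_isPositive [SigmaFinite μ] [TopologicalSpace.SeparableSpace K]
    {T : Lp K 2 μ →L[ℂ] Lp K 2 μ} {R : X → K →L[ℂ] K}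
    (h : IsDirectIntegral T R) (hT : T.IsPositive) : ∀ᵐ x ∂μ, (R x).IsPositive := by
  rw [ContinuousLinearMap.isPositive_iff_complex] at hT
  have hu : ∀ u : K, ∀ᵐ x ∂μ,
      0 ≤ RCLike.re ⟪u, R x u⟫_ℂ ∧ RCLike.im ⟪u, R x u⟫_ℂ = 0 := by
    intro u
    -- Positivity of `T` at $1_su$ makes $\int_s\langle u,R(x)u\rangle\,d\mu$ real and nonnegative
    -- for every `s` of finite measure.
    have hfacts : ∀ s : Set X, MeasurableSet s → μ s < ∞ →
        IntegrableOn (fun x => ⟪u, R x u⟫_ℂ) s μ ∧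
        0 ≤ RCLike.re (∫ x in s, ⟪u, R x u⟫_ℂ ∂μ) ∧ RCLike.im (∫ x in s, ⟪u, R x u⟫_ℂ ∂μ) = 0 := by
      intro s hs hμs
      set ψ := indicatorConstLp 2 hs hμs.ne u
      have he : (fun x => ⟪u, T ψ x⟫_ℂ) =ᵐ[μ.restrict s] fun x => ⟪u, R x u⟫_ℂ := by
        rw [Filter.EventuallyEq, ae_restrict_iff' hs]
        filter_upwards [h.apply_ae ψ,
          indicatorConstLp_coeFn (p := 2) (hs := hs) (hμs := hμs.ne) (c := u)] with x h1 h3 hx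
        rw [h1, h3, Set.indicator_of_mem hx]
      have hi : IntegrableOn (fun x => ⟪u, T ψ x⟫_ℂ) s μ := by
        refine ((L2.integrable_inner (𝕜 := ℂ) ψ (T ψ)).integrableOn (s := s)).congr ?_
        rw [Filter.EventuallyEq, ae_restrict_iff' hs]
        filter_upwards [indicatorConstLp_coeFn (p := 2) (hs := hs) (hμs := hμs.ne) (c := u)]
          with x h3 hx
        rw [h3, Set.indicator_of_mem hx]
      refine ⟨hi.congr he, ?_⟩
      rw [← integral_congr_ae he, ← L2.inner_indicatorConstLp_eq_setIntegral_inner ℂ (T ψ) hs u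
        hμs.ne, ← inner_conj_symm, RCLike.conj_re, RCLike.conj_im]
      obtain ⟨h1, h2⟩ := hT ψ
      refine ⟨h2, ?_⟩
      rw [← h1]
      simp
    have hre : 0 ≤ᵐ[μ] fun x => RCLike.re ⟪u, R x u⟫_ℂ :=
      ae_nonneg_of_forall_setIntegral_nonneg_of_sigmaFinite
        (fun s hs hμs => (hfacts s hs hμs).1.re) fun s hs hμs => by
          rw [integral_re (hfacts s hs hμs).1]
          exact (hfacts s hs hμs).2.1
    have him : (fun x => RCLike.im ⟪u, R x u⟫_ℂ) =ᵐ[μ] 0 :=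
      ae_eq_zero_of_forall_setIntegral_eq_of_sigmaFinite
        (fun s hs hμs => (hfacts s hs hμs).1.im) fun s hs hμs => by
          rw [integral_im (hfacts s hs hμs).1]
          exact (hfacts s hs hμs).2.2
    filter_upwards [hre, him] with x h1 h2
    exact ⟨h1, h2⟩
  filter_upwards [ae_all_iff.2 fun n => hu (TopologicalSpace.denseSeq K n)] with x hx
  have hall : ∀ u, 0 ≤ RCLike.re ⟪u, R x u⟫_ℂ ∧ RCLike.im ⟪u, R x u⟫_ℂ = 0 := by
    intro u
    have hcont : Continuous fun u => ⟪u, R x u⟫_ℂ := by fun_prop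
    refine (TopologicalSpace.denseRange_denseSeq K).induction_on
      (p := fun u => 0 ≤ RCLike.re ⟪u, R x u⟫_ℂ ∧ RCLike.im ⟪u, R x u⟫_ℂ = 0) u ?_ hx
    exact (isClosed_le continuous_const (RCLike.continuous_re.comp hcont)).inter
      (isClosed_eq (RCLike.continuous_im.comp hcont) continuous_const)
  rw [ContinuousLinearMap.isPositive_iff_complex]
  intro u
  obtain ⟨h1, h2⟩ := hall u
  rw [← inner_conj_symm, RCLike.conj_re]
  refine ⟨?_, h1⟩
  rw [RCLike.ext_iff, RCLike.conj_re, RCLike.conj_im, h2]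
  simp

end DirectIntegral

/-! ### Parseval determining sets and Bessel bounds -/

section BesselMultiplications

variable {X : Type*} [MeasurableSpace X] {μ : Measure X}
  {Y : Type*} [MeasurableSpace Y] {ν : Measure Y} {g : Y → Lp ℂ ∞ μ}
  {I : Type*} {K : Type*} [NormedAddCommGroup K] [InnerProductSpace ℂ K]

theorem L2_lintegral_enorm_sq {F : Type*} [NormedAddCommGroup F] (ψ : Lp F 2 μ) :
    ∫⁻ x, ‖ψ x‖ₑ ^ 2 ∂μ = ENNReal.ofReal (‖ψ‖ ^ 2) := by
  have h : ENNReal.ofReal (‖ψ‖ ^ 2) = eLpNorm ψ 2 μ ^ 2 := by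
    rw [ENNReal.ofReal_pow (norm_nonneg _), Lp.norm_def, ENNReal.ofReal_toReal (Lp.eLpNorm_ne_top ψ)]
  rw [h, eLpNorm_eq_lintegral_rpow_enorm_toReal (by norm_num) (by norm_num)]
  simp only [ENNReal.toReal_ofNat, ENNReal.rpow_ofNat]
  rw [← ENNReal.rpow_natCast, ← ENNReal.rpow_mul]
  norm_num

/-- The pointwise inner product of two $L^2$ fields is only known to be in $L^1$, which is where the
Parseval identity is assumed. -/
theorem inner_mulOp (γ : Lp ℂ ∞ μ) (ψ v : Lp K 2 μ) :
    ⟪mulOp γ ψ, v⟫_ℂ =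
      ∫ x, (L2.integrable_inner (𝕜 := ℂ) ψ v).toL1 _ x * (starRingEnd ℂ) (γ x) ∂μ := by
  rw [L2.inner_def]
  refine integral_congr_ae ?_
  filter_upwards [mulOp_coeFn γ ψ, (L2.integrable_inner (𝕜 := ℂ) ψ v).coeFn_toL1] with x h1 h2
  rw [h1, h2, inner_smul_left, mul_comm]

theorem IsParsevalDeterminingSet.measurable_inner (hg : IsParsevalDeterminingSet ν g)
    (ψ v : Lp K 2 μ) : Measurable fun t => ⟪mulOp (g t) ψ, v⟫_ℂ := by
  simp only [inner_mulOp]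
  exact hg.measurable_integral _

theorem IsParsevalDeterminingSet.lintegral_inner (hg : IsParsevalDeterminingSet ν g)
    (ψ v : Lp K 2 μ) :
    ∫⁻ t, ‖⟪mulOp (g t) ψ, v⟫_ℂ‖ₑ ^ 2 ∂ν = ∫⁻ x, ‖⟪ψ x, v x⟫_ℂ‖ₑ ^ 2 ∂μ := by
  simp only [inner_mulOp]
  rw [hg.parseval]
  refine lintegral_congr_ae ?_
  filter_upwards [(L2.integrable_inner (𝕜 := ℂ) ψ v).coeFn_toL1] with x h2
  rw [h2]

/-- An integrable function annihilated by a Parseval determining set vanishes. -/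
theorem IsParsevalDeterminingSet.ae_eq_zero (hg : IsParsevalDeterminingSet ν g) {f : X → ℂ}
    (hf : Integrable f μ) (h : ∀ t, ∫ x, f x * (starRingEnd ℂ) (g t x) ∂μ = 0) : f =ᵐ[μ] 0 := by
  have h1 := hg.parseval (hf.toL1 f)
  have h2 : ∀ t, ∫ x, hf.toL1 f x * (starRingEnd ℂ) (g t x) ∂μ = 0 := by
    intro t
    rw [← h t]
    refine integral_congr_ae ?_
    filter_upwards [hf.coeFn_toL1] with x hx
    rw [hx]
  simp only [h2] at h1
  have h3 : ∫⁻ x, ‖hf.toL1 f x‖ₑ ^ 2 ∂μ = 0 := by rw [← h1]; simp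
  rw [lintegral_eq_zero_iff' ((Lp.aestronglyMeasurable _).enorm.pow_const 2)] at h3
  filter_upwards [h3, hf.coeFn_toL1] with x h4 h5
  have h6 : ‖hf.toL1 f x‖ₑ ^ 2 = 0 := h4
  rw [h5] at h6
  simpa using h6

/-- Unitarily equivalent systems of multiplications have almost everywhere the same fiberwise Gram
kernels. -/
theorem IsParsevalDeterminingSet.inner_ae_eq [Countable I] {K' : Type*} [NormedAddCommGroup K']
    [InnerProductSpace ℂ K'] (hg : IsParsevalDeterminingSet ν g) {φ : I → Lp K 2 μ}
    {φ' : I → Lp K' 2 μ} (h : UnitarilyEquivalent (mulSystem g φ) (mulSystem g φ')) :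
    ∀ᵐ x ∂μ, ∀ i j, ⟪φ i x, φ j x⟫_ℂ = ⟪φ' i x, φ' j x⟫_ℂ := by
  refine ae_all_iff.2 fun i => ae_all_iff.2 fun j => ?_
  set f : X → ℂ := fun x => ⟪φ i x, φ j x⟫_ℂ - ⟪φ' i x, φ' j x⟫_ℂ
  have hf : Integrable f μ := (L2.integrable_inner (φ i) (φ j)).sub (L2.integrable_inner _ _)
  -- For fixed `s`, the integrable function $g_sf$ is annihilated by every $g_t$, hence vanishes
  -- a.e.; then $f\overline{g_s}=0$ a.e. for all `s`, and Parseval applies again to `f`.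
  have hin : ∀ s t, ∫ x, (g s x * f x) * (starRingEnd ℂ) (g t x) ∂μ = 0 := by
    intro s t
    have h1 := h.inner_eq (t, i) (s, j)
    simp only [mulSystem] at h1
    rw [← sub_eq_zero, L2.inner_def, L2.inner_def,
      ← integral_sub (L2.integrable_inner _ _) (L2.integrable_inner _ _)] at h1
    rw [← h1]
    refine integral_congr_ae ?_
    filter_upwards [mulOp_coeFn (g t) (φ i), mulOp_coeFn (g s) (φ j), mulOp_coeFn (g t) (φ' i),
      mulOp_coeFn (g s) (φ' j)] with x h1 h2 h3 h4
    simp only [f, h1, h2, h3, h4, inner_smul_left, inner_smul_right]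
    ring
  have hs : ∀ s, (fun x => g s x * f x) =ᵐ[μ] 0 := fun s =>
    hg.ae_eq_zero (hf.mul_of_top_right (Lp.memLp (g s))) (hin s)
  have := hg.ae_eq_zero hf fun s => by
    rw [integral_eq_zero_of_ae]
    filter_upwards [hs s] with x hx
    rcases mul_eq_zero.1 hx with h0 | h0 <;> simp [h0]
  filter_upwards [this] with x hx
  exact sub_eq_zero.1 hx

variable [Countable I] [MeasurableSpace I] [DiscreteMeasurableSpace I]

theorem IsParsevalDeterminingSet.measurable_inner_mulSystem (hg : IsParsevalDeterminingSet ν g)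
    (φ : I → Lp K 2 μ) (v : Lp K 2 μ) : Measurable fun p => ⟪mulSystem g φ p, v⟫_ℂ :=
  measurable_from_prod_countable_left fun i => hg.measurable_inner (φ i) v

/-- Tonelli on $Y\times I$ and Parseval for each `i`. This identity carries Bessel bounds both ways
between the system and its fibers. -/
theorem IsParsevalDeterminingSet.lintegral_inner_mulSystem [SigmaFinite ν]
    (hg : IsParsevalDeterminingSet ν g) (φ : I → Lp K 2 μ) (v : Lp K 2 μ) :
    ∫⁻ p, ‖⟪mulSystem g φ p, v⟫_ℂ‖ₑ ^ 2 ∂(ν.prod Measure.count) =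
      ∫⁻ x, ∑' i, ‖⟪φ i x, v x⟫_ℂ‖ₑ ^ 2 ∂μ := by
  rw [lintegral_prod_symm' _ ((hg.measurable_inner_mulSystem φ v).enorm.pow_const 2),
    lintegral_count, lintegral_tsum]
  · exact tsum_congr fun i => hg.lintegral_inner (φ i) v
  · exact fun i => ((Lp.aestronglyMeasurable _).inner (Lp.aestronglyMeasurable _)).enorm.pow_const 2

theorem IsParsevalDeterminingSet.isBesselSystem [SigmaFinite ν]
    (hg : IsParsevalDeterminingSet ν g) {φ : I → Lp K 2 μ} {B : ℝ}
    (hB : ∀ᵐ x ∂μ, ∀ (F : Finset I) (w : K), ∑ i ∈ F, ‖⟪φ i x, w⟫_ℂ‖ ^ 2 ≤ B * ‖w‖ ^ 2) :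
    IsBesselSystem (ν.prod Measure.count) (mulSystem g φ) := by
  -- `B` may fail to be positive, while a Bessel bound must be.
  refine ⟨hg.measurable_inner_mulSystem φ, max B 1, by positivity, fun v => ?_⟩
  rw [hg.lintegral_inner_mulSystem, ENNReal.ofReal_mul (by positivity), ← L2_lintegral_enorm_sq,
    ← lintegral_const_mul' _ _ ENNReal.ofReal_ne_top]
  refine lintegral_mono_ae ?_
  filter_upwards [hB] with x hx
  rw [ENNReal.tsum_eq_iSup_sum]
  refine iSup_le fun F => ?_
  have h1 : ∑ i ∈ F, ‖⟪φ i x, v x⟫_ℂ‖ₑ ^ 2 =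
      ENNReal.ofReal (∑ i ∈ F, ‖⟪φ i x, v x⟫_ℂ‖ ^ 2) := by
    rw [ENNReal.ofReal_sum_of_nonneg fun i _ => by positivity]
    refine Finset.sum_congr rfl fun i _ => ?_
    rw [ENNReal.ofReal_pow (norm_nonneg _), ofReal_norm]
  rw [h1, ← ofReal_norm, ← ENNReal.ofReal_pow (norm_nonneg _), ← ENNReal.ofReal_mul (by positivity)]
  refine ENNReal.ofReal_le_ofReal ((hx F (v x)).trans ?_)
  gcongr
  exact le_max_left _ _

/-- If a system of multiplications is Bessel, then almost every fiber of its generators is a Bessel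
family with the same bound. -/
theorem IsParsevalDeterminingSet.exists_ae_bound [SigmaFinite μ] [SigmaFinite ν]
    [TopologicalSpace.SeparableSpace K]
    (hg : IsParsevalDeterminingSet ν g) {φ : I → Lp K 2 μ}
    (h : IsBesselSystem (ν.prod Measure.count) (mulSystem g φ)) :
    ∃ B : ℝ, 0 ≤ B ∧
      ∀ᵐ x ∂μ, ∀ (F : Finset I) (w : K), ∑ i ∈ F, ‖⟪φ i x, w⟫_ℂ‖ ^ 2 ≤ B * ‖w‖ ^ 2 := by
  obtain ⟨B, hB, hbd⟩ := h.exists_bound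
  refine ⟨B, hB.le, ?_⟩
  have hw : ∀ w : K, ∀ᵐ x ∂μ, ∑' i, ‖⟪φ i x, w⟫_ℂ‖ₑ ^ 2 ≤ ENNReal.ofReal (B * ‖w‖ ^ 2) := by
    intro w
    refine ae_le_of_forall_setLIntegral_le_of_sigmaFinite (g := fun _ => ENNReal.ofReal _)
      (Measurable.tsum fun i =>
        ((Lp.stronglyMeasurable (φ i)).inner stronglyMeasurable_const).measurable.enorm.pow_const 2)
      fun s hs hμs => ?_
    -- Testing the Bessel inequality on $1_sw$ localizes it to `s`.
    set v := indicatorConstLp 2 hs hμs.ne w with hv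
    have hvs := indicatorConstLp_coeFn (p := 2) (hs := hs) (hμs := hμs.ne) (c := w)
    calc ∫⁻ x in s, ∑' i, ‖⟪φ i x, w⟫_ℂ‖ₑ ^ 2 ∂μ
        = ∫⁻ x in s, ∑' i, ‖⟪φ i x, v x⟫_ℂ‖ₑ ^ 2 ∂μ := by
          refine lintegral_congr_ae ?_
          rw [Filter.EventuallyEq, ae_restrict_iff' hs]
          filter_upwards [hvs] with x h3 hx
          rw [hv, h3, Set.indicator_of_mem hx]
      _ ≤ ∫⁻ x, ∑' i, ‖⟪φ i x, v x⟫_ℂ‖ₑ ^ 2 ∂μ := setLIntegral_le_lintegral _ _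
      _ ≤ ENNReal.ofReal (B * ‖v‖ ^ 2) := by
          rw [← hg.lintegral_inner_mulSystem]
          exact hbd v
      _ = ENNReal.ofReal B * ∫⁻ x, ‖v x‖ₑ ^ 2 ∂μ := by
          rw [ENNReal.ofReal_mul hB.le, L2_lintegral_enorm_sq]
      _ = ENNReal.ofReal B * ∫⁻ x, s.indicator (fun _ => ‖w‖ₑ ^ 2) x ∂μ := by
          congr 1
          refine lintegral_congr_ae ?_
          filter_upwards [hvs] with x h3
          rw [hv, h3]
          by_cases hx : x ∈ s <;> simp [hx]
      _ = ∫⁻ _ in s, ENNReal.ofReal (B * ‖w‖ ^ 2) ∂μ := by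
          rw [lintegral_indicator_const hs, setLIntegral_const, ENNReal.ofReal_mul hB.le,
            ENNReal.ofReal_pow (norm_nonneg _), ofReal_norm, mul_assoc]
  filter_upwards [ae_all_iff.2 fun n => hw (TopologicalSpace.denseSeq K n)] with x hx F w
  refine (TopologicalSpace.denseRange_denseSeq K).induction_on
    (p := fun w => ∑ i ∈ F, ‖⟪φ i x, w⟫_ℂ‖ ^ 2 ≤ B * ‖w‖ ^ 2) w
    (isClosed_le (by fun_prop) (by fun_prop)) fun n => ?_
  rw [← ENNReal.ofReal_le_ofReal_iff (by positivity)]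
  refine le_trans ?_ ((ENNReal.sum_le_tsum F).trans (hx n))
  rw [ENNReal.ofReal_sum_of_nonneg fun i _ => by positivity]
  refine Finset.sum_le_sum fun i _ => ?_
  rw [ENNReal.ofReal_pow (norm_nonneg _), ofReal_norm]

end BesselMultiplications

/-- Systems of multiplications whose generators have almost everywhere the same Gram kernels are
unitarily equivalent. -/
theorem unitarilyEquivalent_mulSystem {X Y I K : Type*} [MeasurableSpace X]
    {μ : Measure X} [NormedAddCommGroup K] [InnerProductSpace ℂ K] [CompleteSpace K]
    {K' : Type*} [NormedAddCommGroup K'] [InnerProductSpace ℂ K'] [CompleteSpace K'] (g : Y → Lp ℂ ∞ μ) {φ : I → Lp K 2 μ}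
    {φ' : I → Lp K' 2 μ} (h : ∀ᵐ x ∂μ, ∀ i j, ⟪φ i x, φ j x⟫_ℂ = ⟪φ' i x, φ' j x⟫_ℂ) :
    UnitarilyEquivalent (mulSystem g φ) (mulSystem g φ') := by
  refine unitarilyEquivalent_of_inner_eq fun p q => ?_
  simp only [mulSystem, L2.inner_def]
  refine integral_congr_ae ?_
  filter_upwards [h, mulOp_coeFn (g p.1) (φ p.2), mulOp_coeFn (g q.1) (φ q.2),
    mulOp_coeFn (g p.1) (φ' p.2), mulOp_coeFn (g q.1) (φ' q.2)] with x hx h1 h2 h3 h4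
  rw [h1, h2, h3, h4, inner_smul_left, inner_smul_left, inner_smul_right, inner_smul_right, hx]

/-! ### From generators to operators and back -/

section Correspondence

variable {X : Type*} [MeasurableSpace X] {μ : Measure X}
  {Y : Type*} [MeasurableSpace Y] {ν : Measure Y} {g : Y → Lp ℂ ∞ μ}
  {I : Type*}
  {H : Type*} [NormedAddCommGroup H] [InnerProductSpace ℂ H] [CompleteSpace H]

/-- `T` is the direct integral of the Gramians of the fibers of `φ`. -/
def HasGramianFibers (φ : I → Lp H 2 μ)
    (T : Lp (EllTwo I) 2 μ →L[ℂ] Lp (EllTwo I) 2 μ) : Prop :=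
  ∃ Gr : X → EllTwo I →L[ℂ] EllTwo I, IsDirectIntegral T Gr ∧
    ∀ᵐ x ∂μ, IsGramian (fun i => φ i x) (Gr x)

theorem HasGramianFibers.inner_ae_eq [Countable I] [SigmaFinite μ] {φ φ' : I → Lp H 2 μ}
    {T : Lp (EllTwo I) 2 μ →L[ℂ] Lp (EllTwo I) 2 μ} (h : HasGramianFibers φ T)
    (h' : HasGramianFibers φ' T) :
    ∀ᵐ x ∂μ, ∀ i j, ⟪φ i x, φ j x⟫_ℂ = ⟪φ' i x, φ' j x⟫_ℂ := by
  obtain ⟨Gr, hT, hGr⟩ := h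
  obtain ⟨Gr', hT', hGr'⟩ := h'
  filter_upwards [hT.ae_eq hT', hGr, hGr'] with x h1 h2 h3 i j
  rw [← h2.inner_delta i j, ← h3.inner_delta i j, h1]

theorem HasGramianFibers.eq {φ φ' : I → Lp H 2 μ}
    {T T' : Lp (EllTwo I) 2 μ →L[ℂ] Lp (EllTwo I) 2 μ} (h : HasGramianFibers φ T)
    (h' : HasGramianFibers φ' T')
    (e : ∀ᵐ x ∂μ, ∀ i j, ⟪φ i x, φ j x⟫_ℂ = ⟪φ' i x, φ' j x⟫_ℂ) : T = T' := by
  obtain ⟨Gr, hT, hGr⟩ := h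
  obtain ⟨Gr', hT', hGr'⟩ := h'
  refine ContinuousLinearMap.ext fun ψ => Lp.ext ?_
  filter_upwards [hT.apply_ae ψ, hT'.apply_ae ψ, hGr, hGr', e] with x h1 h2 h3 h4 h5
  rw [h1, h2, h3.congr h4 h5]

variable [Countable I]

/-- Generators with essentially bounded Bessel fibers have a direct integral of Gramians. -/
theorem exists_hasGramianFibers [μ.IsComplete] {φ : I → Lp H 2 μ} {B : ℝ} (hB : 0 ≤ B)
    (hφ : ∀ᵐ x ∂μ, ∀ (F : Finset I) (w : H), ∑ i ∈ F, ‖⟪φ i x, w⟫_ℂ‖ ^ 2 ≤ B * ‖w‖ ^ 2) :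
    ∃ P : PosIntegrableMIOperator μ I (hilbertDim H), HasGramianFibers φ P.1 := by
  classical
  have hex : ∀ᵐ x ∂μ, ∃ G : EllTwo I →L[ℂ] EllTwo I,
      IsGramian (fun i => φ i x) G ∧ ‖G‖ ≤ √B * √B := by
    filter_upwards [hφ] with x hx
    obtain ⟨T, hT, hTB⟩ := exists_analysisOperator hB hx
    refine ⟨_, ⟨T, hT, rfl⟩, (ContinuousLinearMap.opNorm_comp_le _ _).trans ?_⟩
    rw [LinearIsometryEquiv.norm_map]
    gcongr
  let Gr : X → EllTwo I →L[ℂ] EllTwo I := fun x =>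
    if h : ∃ G : EllTwo I →L[ℂ] EllTwo I,
      IsGramian (fun i => φ i x) G ∧ ‖G‖ ≤ √B * √B then h.choose else 0
  have hGr : ∀ᵐ x ∂μ, IsGramian (fun i => φ i x) (Gr x) ∧ ‖Gr x‖ ≤ √B * √B := by
    filter_upwards [hex] with x hx
    simp only [Gr, dif_pos hx]
    exact hx.choose_spec
  -- `Gr` is chosen pointwise; measurability comes from its matrix entries
  -- $\langle\varphi_i(x),\varphi_j(x)\rangle$ up to conjugation convention.
  have hmeas : ∀ u, AEStronglyMeasurable (fun x => Gr x u) μ := by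
    refine fun u => ellTwo_aestronglyMeasurable fun i => ?_
    refine aestronglyMeasurable_of_tendsto_ae (Filter.atTop : Filter (Finset I))
      (f := fun F x => ∑ j ∈ F, u j * ⟪φ i x, φ j x⟫_ℂ)
      (fun F => Finset.aestronglyMeasurable_fun_sum F fun j _ => AEStronglyMeasurable.const_mul
        ((Lp.aestronglyMeasurable _).inner (Lp.aestronglyMeasurable _)) _) ?_
    filter_upwards [hGr] with x hx
    have h1 := ((hasSum_ellTwoDelta u).mapL (Gr x)).mapL (innerSL ℂ (ellTwoDelta i))
    simp only [map_smul, innerSL_apply_apply, smul_eq_mul, hx.1.inner_delta,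
      inner_ellTwoDelta_left] at h1
    exact h1
  obtain ⟨T, hT⟩ := exists_directIntegral (hGr.mono fun x hx => hx.2) hmeas
  have hDI : IsDirectIntegral T Gr :=
    ⟨⟨_, hGr.mono fun x hx => hx.2⟩, fun u v => aemeasurable_iff_measurable.1
      (aestronglyMeasurable_const.inner (hmeas u)).aemeasurable, hT⟩
  refine ⟨⟨T, hDI.isMIOperator, hDI.isPositive (hGr.mono fun x hx => hx.1.isPositive), Gr, hDI,
    fun i => ?_, hGr.mono fun x hx => hx.1.operatorRank_le⟩, Gr, hDI, hGr.mono fun x hx => hx.1⟩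
  refine (L2.integrable_inner (𝕜 := ℂ) (φ i) (φ i)).congr ?_
  filter_upwards [hGr] with x hx
  exact (hx.1.inner_delta i i).symm

/-- Every positive integrable MI operator of rank at most `dim H` is a direct integral of the
Gramians of the fibers of some family with essentially bounded Bessel fibers. -/
theorem PosIntegrableMIOperator.exists_family [SigmaFinite μ] [μ.IsComplete]
    (P : PosIntegrableMIOperator μ I (hilbertDim H)) :
    ∃ (φ : I → Lp H 2 μ) (B : ℝ),
      (∀ᵐ x ∂μ, ∀ (F : Finset I) (w : H), ∑ i ∈ F, ‖⟪φ i x, w⟫_ℂ‖ ^ 2 ≤ B * ‖w‖ ^ 2) ∧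
        HasGramianFibers φ P.1 := by
  classical
  obtain ⟨T, -, hpos, Gr, hDI, hint, hrank⟩ := P
  let a : X → I → EllTwo I := fun x =>
    if h : (Gr x).IsPositive then (exists_family_of_isPositive h).choose else 0
  have hGpos := hDI.ae_isPositive hpos
  have ha : ∀ x, (Gr x).IsPositive →
      (∀ i j, ⟪a x i, a x j⟫_ℂ = ⟪ellTwoDelta i, Gr x (ellTwoDelta j)⟫_ℂ) ∧
        ∀ i, a x i ∈ (LinearMap.range (Gr x : EllTwo I →ₗ[ℂ] EllTwo I)).topologicalClosure := by
    intro x hx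
    simp only [a, dif_pos hx]
    exact (exists_family_of_isPositive hx).choose_spec
  -- `a` is chosen pointwise with no regularity. Its Gram kernel agrees a.e. with the measurable
  -- matrix of `Gr`, hence is measurable because `μ` is complete.
  have ham : ∀ i j, Measurable fun x => ⟪a x i, a x j⟫_ℂ := fun i j =>
    (hDI.measurable (ellTwoDelta j) (ellTwoDelta i)).congr_ae <| by
      filter_upwards [hGpos] with x hx
      exact ((ha x hx).1 i j).symm
  obtain ⟨φ₀, hφ₀m, hφ₀⟩ := exists_stronglyMeasurable_family (H := H) ham
  have hgram : ∀ᵐ x ∂μ, ∀ i j,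
      ⟪ellTwoDelta i, Gr x (ellTwoDelta j)⟫_ℂ = ⟪φ₀ i x, φ₀ j x⟫_ℂ := by
    filter_upwards [hGpos, hrank] with x hx hr i j
    rw [hφ₀ x _ (ha x hx).2 hr, (ha x hx).1]
  -- The diagonal entry of `Gr x` is $\|\varphi_i(x)\|^2$, so integrability is exactly
  -- square-integrability.
  have hL2 : ∀ i, MemLp (φ₀ i) 2 μ := by
    intro i
    rw [memLp_two_iff_integrable_sq_norm (hφ₀m i).aestronglyMeasurable]
    refine (hint i).norm.congr ?_
    filter_upwards [hgram] with x hx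
    rw [hx, inner_self_eq_norm_sq_to_K]
    simp
  let φ : I → Lp H 2 μ := fun i => (hL2 i).toLp
  have hφ : ∀ᵐ x ∂μ, ∀ i, φ i x = φ₀ i x := ae_all_iff.2 fun i => (hL2 i).coeFn_toLp
  have hgram' : ∀ᵐ x ∂μ, IsGramian (fun i => φ i x) (Gr x) ∧
      ∀ (F : Finset I) (w : H), ∑ i ∈ F, ‖⟪φ i x, w⟫_ℂ‖ ^ 2 ≤ ‖Gr x‖ * ‖w‖ ^ 2 := by
    filter_upwards [hgram, hφ] with x h1 h2
    simp only [h2]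
    exact isGramian_of_inner_eq h1
  obtain ⟨C, hC⟩ := hDI.bounded
  refine ⟨φ, C, ?_, Gr, hDI, hgram'.mono fun x hx => hx.1⟩
  filter_upwards [hgram', hC] with x hx hCx F w
  refine (hx.2 F w).trans ?_
  gcongr

end Correspondence

theorem mainTheorem4
    {X : Type*} [MeasurableSpace X] (μ : Measure X) [SigmaFinite μ] [μ.IsComplete]
    [TopologicalSpace.SeparableSpace (Lp ℂ 2 μ)]
    {Y : Type*} [MeasurableSpace Y] (ν : Measure Y) [SigmaFinite ν]
    (g : Y → Lp ℂ ∞ μ) (hg : IsParsevalDeterminingSet ν g)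
    {H : Type*} [NormedAddCommGroup H] [InnerProductSpace ℂ H] [CompleteSpace H]
    [TopologicalSpace.SeparableSpace H]
    {I : Type*} [Countable I] [MeasurableSpace I] [DiscreteMeasurableSpace I] :
    ∃ Φ : Quotient (besselMulSetoid ν g I H) ≃ PosIntegrableMIOperator μ I (hilbertDim H),
      ∀ (φ : I → Lp H 2 μ) (h : IsBesselSystem (ν.prod Measure.count) (mulSystem g φ)),
        ∃ Gr : X → EllTwo I →L[ℂ] EllTwo I,
          IsDirectIntegral
            (Φ (Quotient.mk (besselMulSetoid ν g I H) (BesselMulSystem.of φ h))).1 Gr ∧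
          ∀ᵐ x ∂μ, IsGramian (fun i => φ i x) (Gr x) := by
  have hex : ∀ E : BesselMulSystem ν g I H, ∃ P : PosIntegrableMIOperator μ I (hilbertDim H),
      ∃ φ : I → Lp H 2 μ, E.1 = mulSystem g φ ∧ HasGramianFibers φ P.1 := by
    rintro ⟨_, ⟨φ, rfl⟩, h⟩
    obtain ⟨B, hB, hφ⟩ := hg.exists_ae_bound h
    obtain ⟨P, hP⟩ := exists_hasGramianFibers hB hφ
    exact ⟨P, φ, rfl, hP⟩
  choose P gen hgen hP using hex
  -- The value of `P` depends on neither the chosen generators nor the representative. This one fact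
  -- gives the descent to classes, surjectivity and the Gramian formula.
  have hwd : ∀ (E : BesselMulSystem ν g I H) (Q : PosIntegrableMIOperator μ I (hilbertDim H))
      (φ : I → Lp H 2 μ), HasGramianFibers φ Q.1 →
      UnitarilyEquivalent E.1 (mulSystem g φ) → P E = Q := by
    intro E Q φ hQ hE
    rw [hgen E] at hE
    exact Subtype.ext ((hP E).eq hQ (hg.inner_ae_eq hE))
  let Φ₀ : Quotient (besselMulSetoid ν g I H) → PosIntegrableMIOperator μ I (hilbertDim H) :=
    Quotient.lift P fun E E' hE => hwd E (P E') (gen E') (hP E') (by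
      rw [← hgen E']
      exact hE)
  have hbij : Function.Bijective Φ₀ := by
    constructor
    · intro q q'
      induction q using Quotient.inductionOn with | _ E
      induction q' using Quotient.inductionOn with | _ E'
      intro h
      have h' : P E = P E' := h
      refine Quotient.sound ?_
      change UnitarilyEquivalent E.1 E'.1
      rw [hgen E, hgen E']
      have hE := hP E
      rw [h'] at hE
      exact unitarilyEquivalent_mulSystem g (hE.inner_ae_eq (hP E'))
    · intro Q
      obtain ⟨φ, B, hB, hQ⟩ := Q.exists_family
      exact ⟨Quotient.mk _ (BesselMulSystem.of φ (hg.isBesselSystem hB)),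
        hwd _ Q φ hQ (unitarilyEquivalent_equivalence.refl _)⟩
  refine ⟨Equiv.ofBijective Φ₀ hbij, fun φ h => ?_⟩
  obtain ⟨B, hB, hφ⟩ := hg.exists_ae_bound h
  obtain ⟨Q, hQ⟩ := exists_hasGramianFibers hB hφ
  have hΦ : Φ₀ (Quotient.mk _ (BesselMulSystem.of φ h)) = Q :=
    hwd _ Q φ hQ (unitarilyEquivalent_equivalence.refl _)
  rw [Equiv.ofBijective_apply, hΦ]
  exact hQ
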